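/- **Setting.** Let $N,K\ge 1$, let $\mathcal X\subset\mathbb R^d$ be a context space, $\mathcal W\subset\mathbb R^{d_w}$ a parameter set and $\{f_w:\mathcal X\to\mathbb R\}_{w\in\mathcal W}$ a family of (measurable) utility functions; let $\mathcal S=\{S\subset[N]:|S|\le K\}$. For $X=(x_1,\dots,x_N)\in\mathcal X^N$, $S\in\mathcal S$ and $i\in S$ put $$p(i\mid X,S,w)=\frac{\exp(f_w(x_i))}{1+\sum_{j\in S}\exp(f_w(x_j))},\qquad p(0\mid X,S,w)=\frac{1}{1+\sum_{j\in S}\exp(f_w(x_j))}.$$ Let $\kappa=\inf p(0\mid X,S,w)\,p(i\mid X,S,w)$ over $w\in\mathcal W$, $X\in\mathcal X^N$, $S\in\mathcal S$, $i\in S$. **Assumptions.** (1) The true parameter $w^*$ lies in $\mathcal W$. Put $\mathcal W^*=\{w\in\mathcal W: f_w(x)=f_{w^*}(x)\ \forall x\in\mathcal X\}$. (2) All observed contexts have norm at most $1$; $\|w\|_2\le 1$ for $w\in\mathcal W$; there are constants $C_f\ge 1$, $C_g,C_h>0$ with $|f_w(x)|\le C_f$ for all $w\in\mathcal W$, $x\in\mathcal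 X$, and, for all $x\in\mathcal X$ and all $w$ in the convex hull of $\mathcal W$ (which is $\mathcal W$ itself if $\mathcal W$ is convex), $w\mapsto f_w(x)$ is twice differentiable at $w$ within that hull with $\|\nabla f_w(x)\|_2\le C_g$ and $\|\nabla^2 f_w(x)\|_{\mathrm{op}}\le C_h$. (3) In Phase I the triples $(X_t,S_t,i_t)$, $t=1,\dots,t_0$, are i.i.d.: $X_t\sim\mathcal D$ for a probability distribution $\mathcal D$ on $\mathcal X^N$, $S_t$ is uniform on $\mathcal S$ and independent of $X_t$, and $i_t\in S_t\cup\{0\}$ has conditional probabilities $p(\cdot\mid X_t,S_t,w^*)$. (4) With $\ell_{\mathrm{sq}}(w)=\mathbb E_{X\sim\mathcal D,\,S\sim\mathrm{Unif}(\mathcal S)}\big[\sum_{j\in S}(f_w(x_j)-f_{w^*}(x_j))^2\big]$ and constants $\mu,\tau>0$, $0<\gamma<2$, for every $w\in\mathcal W\setminus\mathcal W^*$, $$\inf_{\tilde w\in\mathcal W^*}\min\Big\{\tfrac\mu2\|w-\tilde w\|_2^2+\ell_{\mathrm{sq}}(\tilde w),\ \tfrac\tau2\|w-\tilde w\|_2^\gamma+\ell_{\mathrm{sq}}(\tilde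 w)\Big\}\le\ell_{\mathrm{sq}}(w).$$ For $\delta\in(0,1)$ let $\zeta=\max\{1,\log K\}\cdot\max\{1,\log(t_0C_g)\}\cdot\max\{1,\log(1/\delta)\}$. **Statement.** There is an absolute constant $C>0$ such that, in every such setting and for every $\delta\in(0,1)$: if $$t_0\ \ge\ \tfrac12\,C\,\kappa^{-2}d_wC_f^2\,\zeta\,\frac{\mu^{\gamma/(2-\gamma)}}{\tau^{2/(2-\gamma)}},$$ then every maximum-likelihood pilot estimator $\hat w_0\in\arg\min_{w\in\mathcal W}\,-\sum_{t=1}^{t_0}\log p(i_t\mid X_t,S_t,w)$ satisfies, with probability at least $1-\delta$, $$\inf_{\tilde w\in\mathcal W^*}\|\hat w_0-\tilde w\|_2^2\ \le\ C\,\frac{\kappa^{-2}d_wC_f^2\,\zeta}{\mu\,t_0}$$ (the infimum is a minimum whenever $\mathcal W$ is closed). -/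

import Mathlib

open MeasureTheory ProbabilityTheory

noncomputable section

namespace MNLBandit

/-- Euclidean space `ℝⁿ` with the `ℓ₂`-norm. -/
abbrev Vec (n : ℕ) : Type := EuclideanSpace ℝ (Fin n)

variable {d m N : ℕ} {ctx : Set (Vec d)}

/-- The assortments: subsets of the `N` items with at most `K` elements. -/
def assortments (N K : ℕ) : Finset (Finset (Fin N)) :=
  Finset.univ.filter fun S => S.card ≤ K

/-- MNL choice probabilities `p(i ∣ X, S, w)`. Choices are elements of `{0, 1, …, N}`: the value `0`
is the outside option and `j.succ` is item `j`. Items that are not offered have probability `0`. -/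
def mnlProb (f : Vec m → ctx → ℝ) (X : Fin N → ctx) (S : Finset (Fin N)) (w : Vec m)
    (i : Fin (N + 1)) : ℝ :=
  Fin.cases (1 / (1 + ∑ j ∈ S, Real.exp (f w (X j))))
    (fun k => if k ∈ S then
        Real.exp (f w (X k)) / (1 + ∑ j ∈ S, Real.exp (f w (X j))) else 0) i

/-- `κ`, the infimum of `p(0 ∣ X, S, w) p(i ∣ X, S, w)` over parameters `w ∈ W`, context sets `X`,
assortments `S` and offered items `i ∈ S`. -/
def kappa (K N : ℕ) (f : Vec m → ctx → ℝ) (W : Set (Vec m)) : ℝ :=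
  sInf {q : ℝ | ∃ w ∈ W, ∃ X : Fin N → ctx, ∃ S ∈ assortments N K, ∃ i ∈ S,
    q = mnlProb f X S w 0 * mnlProb f X S w i.succ}

/-- The equivalence set `W*` of parameters in `W` with the same utility function as `wstar`. -/
def equivSet (f : Vec m → ctx → ℝ) (W : Set (Vec m)) (wstar : Vec m) : Set (Vec m) :=
  {w | w ∈ W ∧ ∀ x : ctx, f w x = f wstar x}

/-- Boundedness of the parameters, of the utilities and of their first and second derivatives in the
parameter. The derivative bounds are required along the convex hull of `W`, which is `W` itself when
`W` is convex, and derivatives are taken within that set, so that `W` need not be open. -/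
structure IsBoundedModel (f : Vec m → ctx → ℝ) (W : Set (Vec m)) (Cf Cg Ch : ℝ) : Prop where
  param : ∀ w ∈ W, ‖w‖ ≤ 1
  utility : ∀ w ∈ W, ∀ x, |f w x| ≤ Cf
  deriv : ∃ (G : Vec m → ctx → Vec m) (H : Vec m → ctx → Vec m →L[ℝ] Vec m),
    ∀ w ∈ convexHull ℝ W, ∀ x,
      HasGradientWithinAt (fun v => f v x) (G w x) (convexHull ℝ W) w ∧
      HasFDerivWithinAt (fun v => G v x) (H w x) (convexHull ℝ W) w ∧
      ‖G w x‖ ≤ Cg ∧ ‖H w x‖ ≤ Ch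

/-- The uniform distribution on the assortments. -/
def unifAssortment (N K : ℕ) : Measure (Finset (Fin N)) :=
  uniformOn (assortments N K : Set (Finset (Fin N)))

/-- The law of one round `(X, S, i)` of uniform exploration: `X ∼ D` and `S ∼ Unif` are independent
and `i` has the conditional probabilities `p(· ∣ X, S, wstar)`. -/
def roundLaw (K : ℕ) (f : Vec m → ctx → ℝ) (wstar : Vec m) (D : Measure (Fin N → ctx)) :
    Measure ((Fin N → ctx) × Finset (Fin N) × Fin (N + 1)) :=
  (D.prod ((unifAssortment N K).prod Measure.count)).withDensity fun z =>
    ENNReal.ofReal (mnlProb f z.1 z.2.1 wstar z.2.2)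

/-- The expected squared loss over `X ∼ D` and a uniformly sampled assortment. -/
def sqLoss (K : ℕ) (f : Vec m → ctx → ℝ) (wstar : Vec m) (D : Measure (Fin N → ctx))
    (w : Vec m) : ℝ :=
  ∫ z : (Fin N → ctx) × Finset (Fin N),
    ∑ j ∈ z.2, (f w (z.1 j) - f wstar (z.1 j)) ^ 2 ∂(D.prod (unifAssortment N K))

/-- The generalized geometric condition: for all `w ∈ W \ W*`, the smaller of the
`μ`-strong-convexity and the `(τ, γ)`-growth lower bounds, minimized over `W*`, is at most the
squared loss at `w`. -/
def GeometricCondition (K : ℕ) (f : Vec m → ctx → ℝ) (W : Set (Vec m)) (wstar : Vec m)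
    (D : Measure (Fin N → ctx)) (μ τ γ : ℝ) : Prop :=
  ∀ w ∈ W \ equivSet f W wstar,
    (⨅ v : equivSet f W wstar,
      min (μ / 2 * ‖w - v‖ ^ 2 + sqLoss K f wstar D v)
        (τ / 2 * ‖w - v‖ ^ γ + sqLoss K f wstar D v)) ≤ sqLoss K f wstar D w

/-- Phase I (`n` rounds): the triples `(X_t, S_t, i_t)` are i.i.d. with law `roundLaw`. -/
structure IsPhaseI {Ω : Type*} [MeasurableSpace Ω] (P : Measure Ω) (K n : ℕ)
    (f : Vec m → ctx → ℝ) (wstar : Vec m) (D : Measure (Fin N → ctx))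
    (X : Fin n → Ω → Fin N → ctx) (S : Fin n → Ω → Finset (Fin N))
    (c : Fin n → Ω → Fin (N + 1)) : Prop where
  law : ∀ t, HasLaw (fun ω => (X t ω, S t ω, c t ω)) (roundLaw K f wstar D) P
  indep : iIndepFun (fun t ω => (X t ω, S t ω, c t ω)) P

/-- Negative log-likelihood of the observations `(X_t, S_t, i_t)`, `t < n`. -/
def negLogLik {n : ℕ} (f : Vec m → ctx → ℝ) (X : Fin n → Fin N → ctx)
    (S : Fin n → Finset (Fin N)) (c : Fin n → Fin (N + 1)) (w : Vec m) : ℝ :=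
  -∑ t, Real.log (mnlProb f (X t) (S t) w (c t))

/-- The logarithmic term `log K · log (n C_g) · log (1/δ)`, each factor being read as at least `1`
(the product is meaningless as an error bound when, say, `K = 1`). -/
def zeta (K n : ℕ) (Cg δ : ℝ) : ℝ :=
  max 1 (Real.log K) * max 1 (Real.log (n * Cg)) * max 1 (Real.log (1 / δ))

end MNLBandit

end

/-!
The proof compares likelihoods through the Hellinger affinity, so no bound on the log-likelihood
ratio enters the rate.

For a fixed parameter `w`, the expectation of `exp (½ log (p_w / p_{w*}))` in one round is the mean
over `(X, S)` of the affinity `∑ᵢ √(p_w(i) p_{w*}(i))`. By `sq_mul_sum_sq_le`, one minus the affinity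
is at least `κ²/16 · ∑_{j ∈ S} (f_w(x_j) - f_{w*}(x_j))²`: utilities are differences of
log-probabilities, all probabilities involved are at least `κ`, and `|S| κ ≤ 1`. Hence the
expectation is at most `exp (-κ²/16 · sqLoss w)` (`integral_exp_halfLogRatio_le`), and independence
with Markov's inequality gives an exponential tail for half the log-likelihood ratio of the whole
sample (`measure_sum_halfLogRatio_ge_le`).

A union bound extends this to a `1/(n C_g)`-net of the parameter set, whose cardinality a volume
argument bounds by `(1 + 2 n C_g)^{d_w}` (`exists_finset_net`). Moving from the maximum-likelihood
estimator to the nearest net point changes each log-probability by at most `2/n`, so half the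
log-likelihood ratio at that point is at least `-1`. Off the exceptional event this forces
`sqLoss ≤ 162 κ⁻² d_w C_f² ζ / n` at the estimator (`sqLoss_le_of_not_tail`). The geometric condition
turns the bound on the loss into a bound on the distance to the equivalence set: the lower bound on
the sample size is what excludes the `(τ, γ)`-branch of the minimum.
-/

namespace MNLBandit

/-! ### Nets of subsets of the unit ball -/

/-- Balls of radius `ε / 2` around the points of `s` are disjoint and contained in the ball of radius
`1 + ε / 2`; comparing volumes bounds their number. -/
theorem card_le_of_separated {E : Type*} [NormedAddCommGroup E] [NormedSpace ℝ E]
    [FiniteDimensional ℝ E] (s : Finset E) {ε : ℝ} (hε : 0 < ε) (hs : ∀ x ∈ s, ‖x‖ ≤ 1)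
    (hsep : ∀ x ∈ s, ∀ y ∈ s, x ≠ y → ε ≤ ‖x - y‖) :
    (s.card : ℝ) ≤ (1 + 2 / ε) ^ Module.finrank ℝ E := by
  borelize E
  let ν : Measure E := Measure.addHaar
  have hδ : 0 < ε / 2 := by positivity
  have hρ : 0 < 1 + ε / 2 := by positivity
  have hdisj : (s : Set E).Pairwise (Function.onFun Disjoint fun x => Metric.ball x (ε / 2)) := by
    intro x hx y hy hxy
    apply Metric.ball_disjoint_ball
    rw [dist_eq_norm, add_halves]
    exact hsep x hx y hy hxy
  have hsub : ⋃ x ∈ s, Metric.ball x (ε / 2) ⊆ Metric.ball (0 : E) (1 + ε / 2) := by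
    refine Set.iUnion₂_subset fun x hx => Metric.ball_subset_ball' ?_
    rw [dist_zero_right]
    linarith [hs x hx]
  have hvol : (s.card : ENNReal) * ENNReal.ofReal ((ε / 2) ^ Module.finrank ℝ E) *
      ν (Metric.ball 0 1) ≤
        ENNReal.ofReal ((1 + ε / 2) ^ Module.finrank ℝ E) * ν (Metric.ball 0 1) := by
    have h := measure_mono (μ := ν) hsub
    rw [measure_biUnion_finset hdisj fun x _ => measurableSet_ball] at h
    simpa only [ν.addHaar_ball_of_pos _ hδ, ν.addHaar_ball_of_pos _ hρ, Finset.sum_const,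
      nsmul_eq_mul, mul_assoc] using h
  have hcard := ENNReal.toReal_le_of_le_ofReal (by positivity)
    ((ENNReal.mul_le_mul_iff_left (Metric.measure_ball_pos _ _ zero_lt_one).ne'
      measure_ball_lt_top.ne).1 hvol)
  rw [ENNReal.toReal_mul, ENNReal.toReal_natCast, ENNReal.toReal_ofReal (by positivity)] at hcard
  have hsplit : 1 + ε / 2 = (1 + 2 / ε) * (ε / 2) := by field_simp; ring
  rw [hsplit, mul_pow] at hcard
  exact le_of_mul_le_mul_right hcard (by positivity)

/-- The net consists of points of `W` itself, so that the assumptions on the model hold at its points: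
a maximal `ε`-separated subset of `W` is such a net. -/
theorem exists_finset_net {E : Type*} [NormedAddCommGroup E] [NormedSpace ℝ E]
    [FiniteDimensional ℝ E] {W : Set E} (hW : ∀ w ∈ W, ‖w‖ ≤ 1) {ε : ℝ} (hε : 0 < ε) :
    ∃ s : Finset E, (s : Set E) ⊆ W ∧ (s.card : ℝ) ≤ (1 + 2 / ε) ^ Module.finrank ℝ E ∧
      ∀ w ∈ W, ∃ v ∈ s, ‖w - v‖ ≤ ε := by
  classical
  let A : Set ℕ := {n | ∃ s : Finset E, (s : Set E) ⊆ W ∧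
    (∀ x ∈ s, ∀ y ∈ s, x ≠ y → ε ≤ ‖x - y‖) ∧ s.card = n}
  have hA : BddAbove A := by
    refine ⟨⌊(1 + 2 / ε) ^ Module.finrank ℝ E⌋₊, ?_⟩
    rintro n ⟨s, hsW, hsep, rfl⟩
    exact Nat.le_floor (card_le_of_separated s hε (fun x hx => hW x (hsW hx)) hsep)
  obtain ⟨s, hsW, hsep, hcard⟩ := Nat.sSup_mem (s := A) ⟨0, ∅, by simp, by simp, rfl⟩ hA
  refine ⟨s, hsW, card_le_of_separated s hε (fun x hx => hW x (hsW hx)) hsep, ?_⟩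
  intro w hw
  by_contra! hfar
  have hws : w ∉ s := fun h => by
    have := hfar w h
    rw [sub_self, norm_zero] at this
    exact absurd this hε.not_gt
  -- A point far from all of `s` could be added to it, against maximality.
  have hmem : s.card + 1 ∈ A := by
    refine ⟨insert w s, ?_, ?_, Finset.card_insert_of_notMem hws⟩
    · rw [Finset.coe_insert]
      exact Set.insert_subset hw hsW
    · intro x hx y hy hxy
      rcases Finset.mem_insert.1 hx with rfl | hx' <;> rcases Finset.mem_insert.1 hy with rfl | hy'
      · exact absurd rfl hxy
      · exact (hfar y hy').le
      · rw [norm_sub_rev]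
        exact (hfar x hx').le
      · exact hsep x hx' y hy' hxy
  have := le_csSup hA hmem
  omega

variable {d m N : ℕ} {ctx : Set (Vec d)}

/-- The set `W` need not be convex: the mean value inequality is applied on its convex hull, where the
gradient bound is assumed. -/
theorem IsBoundedModel.lipschitz {f : Vec m → ctx → ℝ} {W : Set (Vec m)} {Cf Cg Ch : ℝ}
    (h : IsBoundedModel f W Cf Cg Ch) {v w : Vec m} (hv : v ∈ W) (hw : w ∈ W) (x : ctx) :
    |f w x - f v x| ≤ Cg * ‖w - v‖ := by
  obtain ⟨G, H, hGH⟩ := h.deriv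
  refine (convex_convexHull ℝ W).norm_image_sub_le_of_norm_hasFDerivWithin_le
    (f := fun u => f u x) (fun u hu => (hGH u hu x).1.hasFDerivWithinAt) (fun u hu => ?_)
    (subset_convexHull ℝ W hv) (subset_convexHull ℝ W hw)
  rw [LinearIsometryEquiv.norm_map]
  exact (hGH u hu x).2.2.1

/-! ### Choice probabilities -/

section Choice

variable {f : Vec m → ctx → ℝ} {X : Fin N → ctx} {S : Finset (Fin N)} {v w : Vec m}

theorem one_add_sum_exp_pos (f : Vec m → ctx → ℝ) (X : Fin N → ctx) (S : Finset (Fin N))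
    (w : Vec m) : 0 < 1 + ∑ j ∈ S, Real.exp (f w (X j)) := by
  positivity

theorem mnlProb_zero : mnlProb f X S w 0 = 1 / (1 + ∑ j ∈ S, Real.exp (f w (X j))) := rfl

theorem mnlProb_succ (k : Fin N) : mnlProb f X S w k.succ =
    if k ∈ S then Real.exp (f w (X k)) / (1 + ∑ j ∈ S, Real.exp (f w (X j))) else 0 := rfl

theorem mnlProb_zero_pos : 0 < mnlProb f X S w 0 := by
  rw [mnlProb_zero]
  positivity

theorem mnlProb_nonneg (i : Fin (N + 1)) : 0 ≤ mnlProb f X S w i := by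
  cases i using Fin.cases with
  | zero => exact mnlProb_zero_pos.le
  | succ k =>
    rw [mnlProb_succ]
    split_ifs <;> positivity

/-- A sum over all choices reduces to the outside option and the offered items. -/
theorem sum_fin_eq_of_offered (F : Fin (N + 1) → ℝ) (hF : ∀ k ∉ S, F k.succ = 0) :
    ∑ i, F i = F 0 + ∑ k ∈ S, F k.succ := by
  rw [Fin.sum_univ_succ]
  congr 1
  exact (Finset.sum_subset (Finset.subset_univ S) fun k _ hk => hF k hk).symm

theorem sum_mnlProb : ∑ i, mnlProb f X S w i = 1 := by
  have hpos := one_add_sum_exp_pos f X S w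
  have hS : ∑ k ∈ S, mnlProb f X S w k.succ =
      ∑ k ∈ S, Real.exp (f w (X k)) / (1 + ∑ j ∈ S, Real.exp (f w (X j))) :=
    Finset.sum_congr rfl fun k hk => by rw [mnlProb_succ, if_pos hk]
  rw [sum_fin_eq_of_offered (S := S) _ fun k hk => by rw [mnlProb_succ, if_neg hk], mnlProb_zero,
    hS, ← Finset.sum_div, ← add_div, div_self hpos.ne']

theorem mnlProb_le_one (i : Fin (N + 1)) : mnlProb f X S w i ≤ 1 := by
  rw [← sum_mnlProb (f := f) (X := X) (S := S) (w := w)]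
  exact Finset.single_le_sum (fun j _ => mnlProb_nonneg j) (Finset.mem_univ i)

theorem log_mnlProb_zero :
    Real.log (mnlProb f X S w 0) = -Real.log (1 + ∑ j ∈ S, Real.exp (f w (X j))) := by
  rw [mnlProb_zero, one_div, Real.log_inv]

theorem log_mnlProb_succ {k : Fin N} (hk : k ∈ S) : Real.log (mnlProb f X S w k.succ) =
    f w (X k) - Real.log (1 + ∑ j ∈ S, Real.exp (f w (X j))) := by
  rw [mnlProb_succ, if_pos hk,
    Real.log_div (Real.exp_ne_zero _) (one_add_sum_exp_pos f X S w).ne', Real.log_exp]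

theorem log_one_add_sum_exp_le {η : ℝ} (hη : 0 ≤ η) (h : ∀ x, f w x ≤ f v x + η) :
    Real.log (1 + ∑ j ∈ S, Real.exp (f w (X j))) ≤
      Real.log (1 + ∑ j ∈ S, Real.exp (f v (X j))) + η := by
  have hv := one_add_sum_exp_pos f X S v
  rw [← Real.log_exp η, ← Real.log_mul hv.ne' (Real.exp_ne_zero _)]
  refine Real.log_le_log (one_add_sum_exp_pos f X S w) ?_
  rw [add_mul, Finset.sum_mul, one_mul]
  refine add_le_add (Real.one_le_exp hη) (Finset.sum_le_sum fun j _ => ?_)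
  rw [← Real.exp_add]
  exact Real.exp_le_exp.2 (h _)

/-- Log-probabilities are stable under uniform perturbations of the utility. An item that is not
offered contributes `log 0 - log 0 = 0`. -/
theorem abs_log_mnlProb_sub_le {η : ℝ} (h : ∀ x, |f w x - f v x| ≤ η) (hη : 0 ≤ η)
    (i : Fin (N + 1)) :
    |Real.log (mnlProb f X S w i) - Real.log (mnlProb f X S v i)| ≤ 2 * η := by
  have h1 := log_one_add_sum_exp_le (X := X) (S := S) hη
    fun x => (by linarith [(abs_le.1 (h x)).2] : f w x ≤ f v x + η)
  have h2 := log_one_add_sum_exp_le (X := X) (S := S) hη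
    fun x => (by linarith [(abs_le.1 (h x)).1] : f v x ≤ f w x + η)
  cases i using Fin.cases with
  | zero =>
    rw [log_mnlProb_zero, log_mnlProb_zero, abs_le]
    constructor <;> linarith
  | succ k =>
    by_cases hk : k ∈ S
    · rw [log_mnlProb_succ hk, log_mnlProb_succ hk, abs_le]
      have := abs_le.1 (h (X k))
      constructor <;> linarith
    · rw [mnlProb_succ, mnlProb_succ, if_neg hk, if_neg hk, sub_self, abs_zero]
      positivity

/-- Half the log-likelihood ratio of one observation, for the parameter `w` against `v`. On items that
are not offered it is `0`, through `log 0 = 0`; these have probability zero under every parameter. -/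
noncomputable def halfLogRatio (f : Vec m → ctx → ℝ) (v w : Vec m)
    (z : (Fin N → ctx) × Finset (Fin N) × Fin (N + 1)) : ℝ :=
  (Real.log (mnlProb f z.1 z.2.1 w z.2.2) - Real.log (mnlProb f z.1 z.2.1 v z.2.2)) / 2

/-- The right-hand side is `4 (√p - √q)²`, since `q * exp ((log p - log q) / 2) = √(p q)`. -/
theorem mul_sq_log_sub_log_le {κ p q : ℝ} (hκ : 0 < κ) (hp : κ ≤ p) (hq : κ ≤ q) :
    κ * (Real.log p - Real.log q) ^ 2 ≤
      4 * (p + q - 2 * (q * Real.exp ((Real.log p - Real.log q) / 2))) := by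
  have hp0 : 0 < p := hκ.trans_le hp
  have hq0 : 0 < q := hκ.trans_le hq
  set t := (Real.log p - Real.log q) / 2 with ht
  have hpq : p = q * (Real.exp t * Real.exp t) := by
    rw [← Real.exp_add, ht, add_halves, Real.exp_sub, Real.exp_log hp0, Real.exp_log hq0]
    field_simp
  have hlog : Real.log p - Real.log q = 2 * t := by rw [ht]; ring
  have hqp : q = p * (Real.exp (-t) * Real.exp (-t)) := by
    rw [hpq, Real.exp_neg]
    field_simp
  rw [hlog]
  -- `(√p - √q)²` is `q (exp t - 1)²` and also `p (exp (-t) - 1)²`; the form whose exponent is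
  -- nonnegative allows the bound `exp x - 1 ≥ x ≥ 0`.
  rcases le_total 0 t with h | h
  · have h1 : t ≤ Real.exp t - 1 := by linarith [Real.add_one_le_exp t]
    have h2 : κ * t ^ 2 ≤ q * (Real.exp t - 1) ^ 2 :=
      mul_le_mul hq (pow_le_pow_left₀ h h1 2) (sq_nonneg _) hq0.le
    have h3 : p + q - 2 * (q * Real.exp t) = q * (Real.exp t - 1) ^ 2 := by
      rw [hpq]; ring
    rw [h3]
    linarith
  · have h1 : -t ≤ Real.exp (-t) - 1 := by linarith [Real.add_one_le_exp (-t)]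
    have h2 : κ * (-t) ^ 2 ≤ p * (Real.exp (-t) - 1) ^ 2 :=
      mul_le_mul hp (pow_le_pow_left₀ (by linarith) h1 2) (sq_nonneg _) hp0.le
    have h3 : p + q - 2 * (q * Real.exp t) = p * (Real.exp (-t) - 1) ^ 2 := by
      have h4 : q * Real.exp t = p * Real.exp (-t) := by
        rw [hqp, mul_assoc, mul_assoc, ← Real.exp_add, neg_add_cancel, Real.exp_zero, mul_one]
      rw [h4]
      linear_combination hqp
    rw [h3]
    linarith [neg_sq t]

theorem le_mnlProb_of_le_mul {κ : ℝ}
    (hw : ∀ j ∈ S, κ ≤ mnlProb f X S w 0 * mnlProb f X S w j.succ) {j : Fin N} (hj : j ∈ S) :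
    κ ≤ mnlProb f X S w 0 ∧ κ ≤ mnlProb f X S w j.succ :=
  ⟨(hw j hj).trans (mul_le_of_le_one_right (mnlProb_nonneg _) (mnlProb_le_one _)),
    (hw j hj).trans (mul_le_of_le_one_left (mnlProb_nonneg _) (mnlProb_le_one _))⟩

/-- The probabilities of the offered items are at least `κ` and add up to at most one. -/
theorem card_mul_le_one {κ : ℝ}
    (hw : ∀ j ∈ S, κ ≤ mnlProb f X S w 0 * mnlProb f X S w j.succ) : S.card * κ ≤ 1 := by
  calc (S.card : ℝ) * κ = ∑ _j ∈ S, κ := by rw [Finset.sum_const, nsmul_eq_mul]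
    _ ≤ ∑ j ∈ S, mnlProb f X S w j.succ :=
        Finset.sum_le_sum fun j hj => (le_mnlProb_of_le_mul hw hj).2
    _ ≤ mnlProb f X S w 0 + ∑ j ∈ S, mnlProb f X S w j.succ :=
        le_add_of_nonneg_left (mnlProb_nonneg _)
    _ = 1 := by
        rw [← sum_mnlProb (f := f) (X := X) (S := S) (w := w), sum_fin_eq_of_offered (S := S) _
          fun k hk => by rw [mnlProb_succ, if_neg hk]]

/-- The squared utility differences over an assortment are controlled by the squared Hellinger
distance of the choice distributions. The sum on the right is the affinity `∑ᵢ √(p_w(i) p_v(i))`. -/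
theorem sq_mul_sum_sq_le {κ : ℝ} (hκ : 0 < κ) (hκ1 : κ ≤ 1)
    (hv : ∀ j ∈ S, κ ≤ mnlProb f X S v 0 * mnlProb f X S v j.succ)
    (hw : ∀ j ∈ S, κ ≤ mnlProb f X S w 0 * mnlProb f X S w j.succ) :
    κ ^ 2 * ∑ j ∈ S, (f w (X j) - f v (X j)) ^ 2 ≤
      16 * (1 - ∑ i, mnlProb f X S v i * Real.exp (halfLogRatio f v w (X, S, i))) := by
  -- `T i` is `(√p_w(i) - √p_v(i))²`.
  set T : Fin (N + 1) → ℝ := fun i => mnlProb f X S w i + mnlProb f X S v i -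
    2 * (mnlProb f X S v i * Real.exp (halfLogRatio f v w (X, S, i))) with hT
  have hsum : ∑ i, T i =
      2 * (1 - ∑ i, mnlProb f X S v i * Real.exp (halfLogRatio f v w (X, S, i))) := by
    rw [hT, Finset.sum_sub_distrib, Finset.sum_add_distrib, sum_mnlProb, sum_mnlProb,
      ← Finset.mul_sum]
    ring
  have hsum' : ∑ i, T i = T 0 + ∑ k ∈ S, T k.succ :=
    sum_fin_eq_of_offered (S := S) T fun k hk => by simp [hT, mnlProb_succ, hk]
  have hT0 : 0 ≤ T 0 := by
    have hpos : 0 < min (mnlProb f X S w 0) (mnlProb f X S v 0) :=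
      lt_min mnlProb_zero_pos mnlProb_zero_pos
    have h := mul_sq_log_sub_log_le hpos (min_le_left _ _) (min_le_right _ _)
    have h' : 0 ≤ 4 * T 0 := (mul_nonneg hpos.le (sq_nonneg _)).trans h
    linarith
  have hterm : ∀ j ∈ S, κ * (f w (X j) - f v (X j)) ^ 2 ≤ 8 * (T j.succ + T 0) := by
    intro j hj
    have hv' := le_mnlProb_of_le_mul hv hj
    have hw' := le_mnlProb_of_le_mul hw hj
    have h0 : κ * _ ≤ 4 * T 0 := mul_sq_log_sub_log_le hκ hw'.1 hv'.1
    have h1 : κ * _ ≤ 4 * T j.succ := mul_sq_log_sub_log_le hκ hw'.2 hv'.2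
    set a := Real.log (mnlProb f X S w 0) - Real.log (mnlProb f X S v 0) with ha
    set b := Real.log (mnlProb f X S w j.succ) - Real.log (mnlProb f X S v j.succ) with hb
    have hdiff : f w (X j) - f v (X j) = b - a := by
      rw [ha, hb, log_mnlProb_zero, log_mnlProb_zero, log_mnlProb_succ hj, log_mnlProb_succ hj]
      ring
    have hsq : (b - a) ^ 2 ≤ 2 * b ^ 2 + 2 * a ^ 2 := by
      linarith [sq_nonneg (a + b), sub_sq b a, add_sq a b]
    rw [hdiff]
    linarith [mul_le_mul_of_nonneg_left hsq hκ.le]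
  have hTS : 0 ≤ ∑ k ∈ S, T k.succ := Finset.sum_nonneg fun j hj => by
    have h1 : κ * _ ≤ 4 * T j.succ :=
      mul_sq_log_sub_log_le hκ (le_mnlProb_of_le_mul hw hj).2 (le_mnlProb_of_le_mul hv hj).2
    have : 0 ≤ 4 * T j.succ := (mul_nonneg hκ.le (sq_nonneg _)).trans h1
    linarith
  have hS : κ * ∑ j ∈ S, (f w (X j) - f v (X j)) ^ 2 ≤
      8 * (∑ k ∈ S, T k.succ + S.card * T 0) := by
    rw [Finset.mul_sum]
    refine (Finset.sum_le_sum hterm).trans_eq ?_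
    rw [← Finset.mul_sum, Finset.sum_add_distrib, Finset.sum_const, nsmul_eq_mul]
  have h1 := mul_le_mul_of_nonneg_left hS hκ.le
  have h2 : κ * ∑ k ∈ S, T k.succ ≤ ∑ k ∈ S, T k.succ := mul_le_of_le_one_left hTS hκ1
  have h3 : S.card * κ * T 0 ≤ T 0 := mul_le_of_le_one_left hT0 (card_mul_le_one hw)
  calc κ ^ 2 * ∑ j ∈ S, (f w (X j) - f v (X j)) ^ 2
      = κ * (κ * ∑ j ∈ S, (f w (X j) - f v (X j)) ^ 2) := by ring
    _ ≤ κ * (8 * (∑ k ∈ S, T k.succ + S.card * T 0)) := h1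
    _ = 8 * (κ * ∑ k ∈ S, T k.succ + S.card * κ * T 0) := by ring
    _ ≤ 8 * (∑ k ∈ S, T k.succ + T 0) := by linarith
    _ = _ := by rw [add_comm, ← hsum', hsum]; ring

end Choice

section Kappa

variable {f : Vec m → ctx → ℝ} {W : Set (Vec m)} {K : ℕ}

theorem kappa_le {w : Vec m} (hw : w ∈ W) (X : Fin N → ctx) {S : Finset (Fin N)}
    (hS : S ∈ assortments N K) {j : Fin N} (hj : j ∈ S) :
    kappa K N f W ≤ mnlProb f X S w 0 * mnlProb f X S w j.succ := by
  refine csInf_le ⟨0, ?_⟩ ⟨w, hw, X, S, hS, j, hj, rfl⟩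
  rintro q ⟨w', -, X', S', -, i, -, rfl⟩
  exact mul_nonneg (mnlProb_nonneg _) (mnlProb_nonneg _)

theorem exists_mem_assortments (hN : 1 ≤ N) (hK : 1 ≤ K) :
    ∃ S ∈ assortments N K, ∃ j : Fin N, j ∈ S := by
  refine ⟨{⟨0, hN⟩}, ?_, ⟨0, hN⟩, Finset.mem_singleton_self _⟩
  simpa [assortments] using hK

theorem kappa_le_one (hN : 1 ≤ N) (hK : 1 ≤ K) {w : Vec m} (hw : w ∈ W) (X : Fin N → ctx) :
    kappa K N f W ≤ 1 := by
  obtain ⟨S, hS, j, hj⟩ := exists_mem_assortments hN hK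
  exact (kappa_le hw X hS hj).trans
    (mul_le_one₀ (mnlProb_le_one _) (mnlProb_nonneg _) (mnlProb_le_one _))

theorem kappa_pos (hN : 1 ≤ N) (hK : 1 ≤ K) {Cf : ℝ} (hf : ∀ w ∈ W, ∀ x, |f w x| ≤ Cf)
    {w : Vec m} (hw : w ∈ W) (X : Fin N → ctx) : 0 < kappa K N f W := by
  set c : ℝ := 1 / (1 + N * Real.exp Cf) with hc
  have hc0 : 0 < c := by positivity
  have hlow : 0 < c * (Real.exp (-Cf) * c) := by positivity
  refine hlow.trans_le (le_csInf ?_ ?_)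
  · obtain ⟨S, hS, j, hj⟩ := exists_mem_assortments hN hK
    exact ⟨_, w, hw, X, S, hS, j, hj, rfl⟩
  · rintro q ⟨w', hw', X', S', -, i, hi, rfl⟩
    have hden : 1 + ∑ j ∈ S', Real.exp (f w' (X' j)) ≤ 1 + N * Real.exp Cf := by
      have h1 : ∑ j ∈ S', Real.exp (f w' (X' j)) ≤ S'.card * Real.exp Cf := by
        rw [← nsmul_eq_mul]
        exact Finset.sum_le_card_nsmul _ _ _ fun j _ =>
          Real.exp_le_exp.2 (abs_le.1 (hf w' hw' _)).2
      have h2 : (S'.card : ℝ) ≤ N := by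
        exact_mod_cast (Finset.card_le_univ S').trans_eq (Fintype.card_fin N)
      have h3 := mul_le_mul_of_nonneg_right h2 (Real.exp_pos Cf).le
      linarith
    have h0 : c ≤ mnlProb f X' S' w' 0 :=
      one_div_le_one_div_of_le (one_add_sum_exp_pos f X' S' w') hden
    have h1 : Real.exp (-Cf) * c ≤ mnlProb f X' S' w' i.succ := by
      rw [mnlProb_succ, if_pos hi, div_eq_mul_one_div]
      exact mul_le_mul (Real.exp_le_exp.2 (abs_le.1 (hf w' hw' _)).1) h0 hc0.le (Real.exp_pos _).le
    exact mul_le_mul h0 h1 (by positivity) (mnlProb_nonneg _)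

end Kappa

/-! ### The law of one round -/

section Law

variable {f : Vec m → ctx → ℝ} {K : ℕ} {v w : Vec m} {D : Measure (Fin N → ctx)}

theorem measurable_sum_sq (hv : Measurable (f v)) (hw : Measurable (f w)) :
    Measurable fun z : (Fin N → ctx) × Finset (Fin N) =>
      ∑ j ∈ z.2, (f w (z.1 j) - f v (z.1 j)) ^ 2 := by
  refine measurable_from_prod_countable_left fun S => ?_
  exact Finset.measurable_sum S fun j _ => by fun_prop

theorem measurable_mnlProb (hw : Measurable (f w)) :
    Measurable fun z : (Fin N → ctx) × Finset (Fin N) × Fin (N + 1) =>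
      mnlProb f z.1 z.2.1 w z.2.2 := by
  refine measurable_from_prod_countable_left fun y => ?_
  obtain ⟨S, i⟩ := y
  cases i using Fin.cases with
  | zero =>
    simp only [mnlProb_zero]
    fun_prop
  | succ k =>
    simp only [mnlProb_succ]
    split_ifs <;> fun_prop

theorem measurable_halfLogRatio (hv : Measurable (f v)) (hw : Measurable (f w)) :
    Measurable (halfLogRatio (N := N) f v w) := by
  have h1 := measurable_mnlProb (N := N) hv
  have h2 := measurable_mnlProb (N := N) hw
  unfold halfLogRatio
  fun_prop

theorem abs_halfLogRatio_le {η : ℝ} (h : ∀ x, |f w x - f v x| ≤ η) (hη : 0 ≤ η)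
    (z : (Fin N → ctx) × Finset (Fin N) × Fin (N + 1)) : |halfLogRatio f v w z| ≤ η := by
  have := abs_log_mnlProb_sub_le (X := z.1) (S := z.2.1) h hη z.2.2
  rw [halfLogRatio, abs_div, abs_two]
  linarith

theorem assortments_nonempty (N K : ℕ) : (assortments N K).Nonempty :=
  ⟨∅, by simp [assortments]⟩

instance isProbabilityMeasure_unifAssortment (N K : ℕ) :
    IsProbabilityMeasure (unifAssortment N K) :=
  isProbabilityMeasure_uniformOn (Finset.finite_toSet _) (assortments_nonempty N K)

theorem ae_mem_assortments [IsProbabilityMeasure D] :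
    ∀ᵐ z ∂D.prod (unifAssortment N K), z.2 ∈ assortments N K := by
  have h : ∀ᵐ S ∂unifAssortment N K, S ∈ assortments N K := by
    rw [ae_iff]
    exact (uniformOn_eq_zero_iff (Finset.finite_toSet _)).2 (by ext S; simp)
  exact Measure.quasiMeasurePreserving_snd.ae h

theorem integrable_sum_sq [IsProbabilityMeasure D] (hv : Measurable (f v)) (hw : Measurable (f w))
    {B : ℝ} (hB : ∀ x, |f w x - f v x| ≤ B) :
    Integrable (fun z : (Fin N → ctx) × Finset (Fin N) =>
      ∑ j ∈ z.2, (f w (z.1 j) - f v (z.1 j)) ^ 2) (D.prod (unifAssortment N K)) := by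
  refine Integrable.of_bound (measurable_sum_sq hv hw).aestronglyMeasurable (N * B ^ 2)
    (Filter.Eventually.of_forall fun z => ?_)
  rw [Real.norm_of_nonneg (Finset.sum_nonneg fun j _ => sq_nonneg _)]
  calc ∑ j ∈ z.2, (f w (z.1 j) - f v (z.1 j)) ^ 2 ≤ z.2.card • B ^ 2 :=
        Finset.sum_le_card_nsmul _ _ _ fun j _ => sq_le_sq' (abs_le.1 (hB _)).1 (abs_le.1 (hB _)).2
    _ ≤ N * B ^ 2 := by
        rw [nsmul_eq_mul]
        have : (z.2.card : ℝ) ≤ N := by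
          exact_mod_cast (Finset.card_le_univ z.2).trans_eq (Fintype.card_fin N)
        exact mul_le_mul_of_nonneg_right this (sq_nonneg B)

/-- The exponential moment of half the log-likelihood ratio under the law at `v` is the mean Hellinger
affinity. -/
theorem integral_exp_halfLogRatio [IsProbabilityMeasure D] (hv : Measurable (f v))
    (hw : Measurable (f w)) {B : ℝ} (hB0 : 0 ≤ B) (hB : ∀ x, |f w x - f v x| ≤ B) :
    Integrable (fun z : (Fin N → ctx) × Finset (Fin N) =>
        ∑ i, mnlProb f z.1 z.2 v i * Real.exp (halfLogRatio f v w (z.1, z.2, i)))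
      (D.prod (unifAssortment N K)) ∧
    ∫ z, Real.exp (halfLogRatio f v w z) ∂roundLaw K f v D =
      ∫ z, ∑ i, mnlProb f z.1 z.2 v i * Real.exp (halfLogRatio f v w (z.1, z.2, i))
        ∂D.prod (unifAssortment N K) := by
  have hp := measurable_mnlProb (N := N) hv
  have hg := measurable_halfLogRatio (N := N) hv hw
  have hmp := measurePreserving_prodAssoc D (unifAssortment N K)
    (Measure.count (α := Fin (N + 1)))
  have hint : Integrable (fun y : ((Fin N → ctx) × Finset (Fin N)) × Fin (N + 1) =>
      mnlProb f y.1.1 y.1.2 v y.2 * Real.exp (halfLogRatio f v w (y.1.1, y.1.2, y.2)))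
      ((D.prod (unifAssortment N K)).prod Measure.count) := by
    refine Integrable.of_bound (C := Real.exp B) ?_ (Filter.Eventually.of_forall fun y => ?_)
    · exact ((hp.mul hg.exp).comp hmp.measurable).aestronglyMeasurable
    · rw [Real.norm_of_nonneg (mul_nonneg (mnlProb_nonneg _) (Real.exp_pos _).le)]
      refine (mul_le_of_le_one_left (Real.exp_pos _).le (mnlProb_le_one _)).trans ?_
      exact Real.exp_le_exp.2 ((le_abs_self _).trans (abs_halfLogRatio_le hB hB0 _))
  refine ⟨?_, ?_⟩
  · simpa only [integral_count] using hint.integral_prod_left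
  · rw [roundLaw, integral_withDensity_eq_integral_toReal_smul hp.ennreal_ofReal
      (Filter.Eventually.of_forall fun z => ENNReal.ofReal_lt_top)]
    simp only [smul_eq_mul, ENNReal.toReal_ofReal (mnlProb_nonneg _)]
    rw [← hmp.integral_comp MeasurableEquiv.prodAssoc.measurableEmbedding]
    refine (integral_prod _ hint).trans ?_
    simp only [integral_count]

theorem integral_exp_halfLogRatio_le [IsProbabilityMeasure D] {κ : ℝ} (hκ : 0 < κ) (hκ1 : κ ≤ 1)
    (hv : Measurable (f v)) (hw : Measurable (f w)) {B : ℝ} (hB0 : 0 ≤ B)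
    (hB : ∀ x, |f w x - f v x| ≤ B)
    (hκv : ∀ (X : Fin N → ctx), ∀ S ∈ assortments N K, ∀ j ∈ S,
      κ ≤ mnlProb f X S v 0 * mnlProb f X S v j.succ)
    (hκw : ∀ (X : Fin N → ctx), ∀ S ∈ assortments N K, ∀ j ∈ S,
      κ ≤ mnlProb f X S w 0 * mnlProb f X S w j.succ) :
    ∫ z, Real.exp (halfLogRatio f v w z) ∂roundLaw K f v D ≤
      Real.exp (-(κ ^ 2 / 16 * sqLoss K f v D w)) := by
  obtain ⟨hint, heq⟩ := integral_exp_halfLogRatio (K := K) (D := D) hv hw hB0 hB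
  have hle : ∫ z, Real.exp (halfLogRatio f v w z) ∂roundLaw K f v D ≤
      ∫ z : (Fin N → ctx) × Finset (Fin N),
        (1 - κ ^ 2 / 16 * ∑ j ∈ z.2, (f w (z.1 j) - f v (z.1 j)) ^ 2)
          ∂D.prod (unifAssortment N K) := by
    rw [heq]
    refine integral_mono_ae hint
      ((integrable_const 1).sub ((integrable_sum_sq hv hw hB).const_mul _)) ?_
    filter_upwards [ae_mem_assortments (K := K) (D := D)] with z hz
    have := sq_mul_sum_sq_le hκ hκ1 (hκv z.1 z.2 hz) (hκw z.1 z.2 hz)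
    linarith
  rw [integral_sub (integrable_const 1) ((integrable_sum_sq hv hw hB).const_mul _),
    integral_const_mul, integral_const, probReal_univ, one_smul] at hle
  exact hle.trans (Real.one_sub_le_exp_neg _)

/-- Passing from `w` to a parameter `u` with a uniformly close utility costs `2 |S| η²`, and
`|S| ≤ 1 / κ`. -/
theorem sqLoss_le_of_close [IsProbabilityMeasure D] {κ η : ℝ} (hκ : 0 < κ) {u : Vec m}
    (hv : Measurable (f v)) (hw : Measurable (f w)) (hu : Measurable (f u)) {B : ℝ}
    (hBw : ∀ x, |f w x - f v x| ≤ B) (hBu : ∀ x, |f u x - f v x| ≤ B)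
    (hη : ∀ x, |f u x - f w x| ≤ η)
    (hκv : ∀ (X : Fin N → ctx), ∀ S ∈ assortments N K, ∀ j ∈ S,
      κ ≤ mnlProb f X S v 0 * mnlProb f X S v j.succ) :
    sqLoss K f v D u ≤ 2 * sqLoss K f v D w + 2 * (η ^ 2 / κ) := by
  have hle : sqLoss K f v D u ≤ ∫ z : (Fin N → ctx) × Finset (Fin N),
      (2 * (∑ j ∈ z.2, (f w (z.1 j) - f v (z.1 j)) ^ 2) + 2 * (η ^ 2 / κ))
        ∂D.prod (unifAssortment N K) := by
    refine integral_mono_ae (integrable_sum_sq hv hu hBu)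
      (((integrable_sum_sq hv hw hBw).const_mul 2).add (integrable_const _)) ?_
    filter_upwards [ae_mem_assortments (K := K) (D := D)] with z hz
    have hcard : (z.2.card : ℝ) ≤ 1 / κ :=
      (le_div_iff₀ hκ).2 (card_mul_le_one (hκv z.1 z.2 hz))
    calc ∑ j ∈ z.2, (f u (z.1 j) - f v (z.1 j)) ^ 2
        ≤ ∑ j ∈ z.2, (2 * (f w (z.1 j) - f v (z.1 j)) ^ 2 + 2 * η ^ 2) := by
          refine Finset.sum_le_sum fun j _ => ?_
          have h1 : (f u (z.1 j) - f w (z.1 j)) ^ 2 ≤ η ^ 2 :=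
            sq_le_sq' (abs_le.1 (hη _)).1 (abs_le.1 (hη _)).2
          have h2 := add_sq_le (a := f w (z.1 j) - f v (z.1 j)) (b := f u (z.1 j) - f w (z.1 j))
          rw [sub_add_sub_cancel'] at h2
          linarith
      _ = 2 * (∑ j ∈ z.2, (f w (z.1 j) - f v (z.1 j)) ^ 2) + 2 * (z.2.card * η ^ 2) := by
          rw [Finset.sum_add_distrib, ← Finset.mul_sum, Finset.sum_const, nsmul_eq_mul]
          ring
      _ ≤ _ := by
          have := mul_le_mul_of_nonneg_right hcard (sq_nonneg η)
          rw [one_div_mul_eq_div] at this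
          linarith
  refine hle.trans_eq ?_
  rw [integral_add ((integrable_sum_sq hv hw hBw).const_mul 2) (integrable_const _),
    integral_const_mul, integral_const, probReal_univ, one_smul]
  rfl

theorem sqLoss_eq_zero {W : Set (Vec m)} {u : Vec m} (hu : u ∈ equivSet f W v) :
    sqLoss K f v D u = 0 := by
  simp [sqLoss, hu.2]

end Law

section Tail

variable {f : Vec m → ctx → ℝ} {K n : ℕ} {v w : Vec m} {D : Measure (Fin N → ctx)}
  {Ω : Type*} [MeasurableSpace Ω] {P : Measure Ω} {X : Fin n → Ω → Fin N → ctx}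
  {S : Fin n → Ω → Finset (Fin N)} {c : Fin n → Ω → Fin (N + 1)}

/-- Markov's inequality for the exponential moment of half the log-likelihood ratio of the sample; `L`
is a lower bound for the decay rate of the exponential moment in one round. -/
theorem measure_sum_halfLogRatio_ge_le [IsProbabilityMeasure P]
    (hdata : IsPhaseI P K n f v D X S c)
    (hv : Measurable (f v)) (hw : Measurable (f w)) {B : ℝ} (hB0 : 0 ≤ B)
    (hB : ∀ x, |f w x - f v x| ≤ B) {L : ℝ}
    (hL : ∫ z, Real.exp (halfLogRatio f v w z) ∂roundLaw K f v D ≤ Real.exp (-L)) (s : ℝ) :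
    P.real {ω | s - n * L ≤ ∑ t, halfLogRatio f v w (X t ω, S t ω, c t ω)} ≤ Real.exp (-s) := by
  set Y : Fin n → Ω → ℝ := fun t ω => halfLogRatio f v w (X t ω, S t ω, c t ω) with hY
  have hg := measurable_halfLogRatio (N := N) hv hw
  have hYm : ∀ t, AEMeasurable (Y t) P := fun t =>
    hg.comp_aemeasurable (hdata.law t).aemeasurable
  have hind : iIndepFun Y P := hdata.indep.comp (fun _ => halfLogRatio f v w) fun _ => hg
  have hmgf : ∀ t, mgf (Y t) P 1 ≤ Real.exp (-L) := by
    intro t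
    have h := (hdata.law t).integral_comp (f := fun z => Real.exp (halfLogRatio f v w z))
      hg.exp.aestronglyMeasurable
    refine le_of_eq_of_le ?_ hL
    rw [← h]
    simp [mgf, hY]
  have hprod : mgf (∑ t, Y t) P 1 ≤ Real.exp (-(n * L)) := by
    rw [hind.mgf_sum₀ hYm]
    refine (Finset.prod_le_prod (fun t _ => mgf_nonneg) fun t _ => hmgf t).trans_eq ?_
    rw [Finset.prod_const, Finset.card_univ, Fintype.card_fin, ← Real.exp_nat_mul, mul_neg]
  have hint : Integrable (fun ω => Real.exp (1 * (∑ t, Y t) ω)) P := by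
    refine Integrable.of_bound (C := Real.exp (n * B)) ?_ (Filter.Eventually.of_forall fun ω => ?_)
    · exact (((Finset.aemeasurable_sum _ fun t _ => hYm t).const_mul 1).exp).aestronglyMeasurable
    · rw [Real.norm_of_nonneg (Real.exp_pos _).le, one_mul, Finset.sum_apply]
      refine Real.exp_le_exp.2 ?_
      have := Finset.sum_le_card_nsmul Finset.univ (fun t => Y t ω) B fun t _ =>
        (le_abs_self _).trans (abs_halfLogRatio_le hB hB0 _)
      simpa [nsmul_eq_mul] using this
  have h := measure_ge_le_exp_mul_mgf (s - n * L) zero_le_one hint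
  simp only [Finset.sum_apply] at h
  refine h.trans ?_
  calc Real.exp (-1 * (s - n * L)) * mgf (∑ t, Y t) P 1
      ≤ Real.exp (-1 * (s - n * L)) * Real.exp (-(n * L)) :=
        mul_le_mul_of_nonneg_left hprod (Real.exp_pos _).le
    _ = Real.exp (-s) := by
        rw [← Real.exp_add]
        congr 1
        ring

end Tail

/-! ### The maximum-likelihood estimator -/

section Estimator

variable {f : Vec m → ctx → ℝ} {W : Set (Vec m)} {K : ℕ} {wstar : Vec m}
  {D : Measure (Fin N → ctx)}

theorem iInf_norm_sub_sq_le {v : Vec m} (hv : v ∈ equivSet f W wstar) (w : Vec m) :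
    ⨅ u : equivSet f W wstar, ‖w - u‖ ^ 2 ≤ ‖w - v‖ ^ 2 := by
  refine ciInf_le (f := fun u : equivSet f W wstar => ‖w - u‖ ^ 2) ⟨0, ?_⟩ ⟨v, hv⟩
  rintro _ ⟨u, rfl⟩
  positivity

/-- Below the threshold `τ^(2/(2-γ)) / μ^(γ/(2-γ))`, the loss controls the squared distance to the
equivalence set, which need not be closed: the factor `4` in place of `2` leaves room for a point
that only nearly attains the infimum. -/
theorem GeometricCondition.iInf_norm_sub_sq_le_of_sqLoss_le {μ τ γ : ℝ} (hμ : 0 < μ) (hτ : 0 < τ)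
    (hγ0 : 0 < γ) (hγ2 : γ < 2) (h : GeometricCondition K f W wstar D μ τ γ)
    (hwstar : wstar ∈ W) {w : Vec m} (hw : w ∈ W) {B : ℝ} (hB : 0 < B)
    (hwB : sqLoss K f wstar D w ≤ B)
    (hsmall : 4 * B * (μ ^ (γ / (2 - γ)) / τ ^ (2 / (2 - γ))) ≤ 1) :
    ⨅ v : equivSet f W wstar, ‖w - v‖ ^ 2 ≤ 4 * B / μ := by
  have hpos : 0 < 4 * B / μ := by positivity
  by_cases hmem : w ∈ equivSet f W wstar
  · refine (iInf_norm_sub_sq_le hmem w).trans ?_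
    rw [sub_self, norm_zero, zero_pow two_ne_zero]
    exact hpos.le
  have : Nonempty (equivSet f W wstar) := ⟨⟨wstar, hwstar, fun _ => rfl⟩⟩
  obtain ⟨⟨v, hv⟩, hlt⟩ := exists_lt_of_ciInf_lt
    ((h w ⟨hw, hmem⟩).trans_lt (hwB.trans_lt (by linarith : B < 2 * B)))
  refine (iInf_norm_sub_sq_le hv w).trans ?_
  simp only [sqLoss_eq_zero hv, add_zero] at hlt
  -- If the `(τ, γ)`-term were the smaller one at a point at squared distance more than `4 B / μ`,
  -- then `τ (4 B / μ)^(γ/2) < 4 B`, which puts `4 B` above the threshold.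
  rcases min_lt_iff.1 hlt with hlt | hlt
  · rw [le_div_iff₀ hμ]
    linarith
  · by_contra! hfar
    set r := ‖w - v‖ with hr
    have hr0 : 0 ≤ r := norm_nonneg _
    have hg : 0 < 2 - γ := by linarith
    have h1 : (4 * B / μ) ^ (γ / 2) ≤ r ^ γ := by
      calc (4 * B / μ) ^ (γ / 2) ≤ (r ^ 2) ^ (γ / 2) :=
            Real.rpow_le_rpow hpos.le hfar.le (by positivity)
        _ = r ^ γ := by
            rw [← Real.rpow_natCast r 2, ← Real.rpow_mul hr0]
            congr 1
            push_cast
            ring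
    have h2 : τ * (4 * B / μ) ^ (γ / 2) < 4 * B := by
      have := mul_le_mul_of_nonneg_left h1 hτ.le
      linarith
    have h3 := Real.rpow_lt_rpow (by positivity) h2 (by positivity : 0 < 2 / (2 - γ))
    have hb : 0 < 4 * B := by positivity
    have hexp : 2 / (2 - γ) = γ / (2 - γ) + 1 := by field_simp; ring
    have h4 : (τ * (4 * B / μ) ^ (γ / 2)) ^ (2 / (2 - γ)) =
        τ ^ (2 / (2 - γ)) * ((4 * B) ^ (γ / (2 - γ)) / μ ^ (γ / (2 - γ))) := by
      rw [Real.mul_rpow hτ.le (by positivity), ← Real.rpow_mul hpos.le,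
        show γ / 2 * (2 / (2 - γ)) = γ / (2 - γ) by field_simp, Real.div_rpow hb.le hμ.le]
    have h5 : (4 * B) ^ (2 / (2 - γ)) = (4 * B) ^ (γ / (2 - γ)) * (4 * B) := by
      rw [hexp, Real.rpow_add_one hb.ne']
    rw [h4, h5] at h3
    have hA : 0 < (4 * B) ^ (γ / (2 - γ)) := by positivity
    have hM : 0 < μ ^ (γ / (2 - γ)) := by positivity
    have hT : 0 < τ ^ (2 / (2 - γ)) := by positivity
    have h6 : τ ^ (2 / (2 - γ)) / μ ^ (γ / (2 - γ)) < 4 * B := by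
      refine lt_of_mul_lt_mul_left ?_ hA.le
      calc _ = τ ^ (2 / (2 - γ)) * ((4 * B) ^ (γ / (2 - γ)) / μ ^ (γ / (2 - γ))) := by ring
        _ < _ := h3
    rw [div_lt_iff₀ hM] at h6
    rw [← mul_div_assoc, div_le_one hT] at hsmall
    exact absurd hsmall h6.not_ge

/-- The likelihood at the minimizer `u` is at least the one at `wstar`, so the log-likelihood ratio at a
parameter `w` close to `u` cannot be very negative. -/
theorem neg_le_sum_halfLogRatio {n : ℕ} {X : Fin n → Fin N → ctx} {S : Fin n → Finset (Fin N)}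
    {c : Fin n → Fin (N + 1)} (hwstar : wstar ∈ W) {u w : Vec m}
    (hu : IsMinOn (negLogLik f X S c) W u) {η : ℝ} (hη : 0 ≤ η)
    (h : ∀ x, |f u x - f w x| ≤ η) :
    -(n * η) ≤ ∑ t, halfLogRatio f wstar w (X t, S t, c t) := by
  have hmle : negLogLik f X S c u ≤ negLogLik f X S c wstar := hu hwstar
  have hsum : ∑ t, halfLogRatio f wstar w (X t, S t, c t) =
      (negLogLik f X S c wstar - negLogLik f X S c w) / 2 := by
    simp only [halfLogRatio, negLogLik, ← Finset.sum_div, Finset.sum_sub_distrib]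
    ring
  have hclose : negLogLik f X S c w ≤ negLogLik f X S c u + n * (2 * η) := by
    have h1 : ∑ t, Real.log (mnlProb f (X t) (S t) u (c t)) ≤
        ∑ t, (Real.log (mnlProb f (X t) (S t) w (c t)) + 2 * η) :=
      Finset.sum_le_sum fun t _ => by
        linarith [(abs_le.1 (abs_log_mnlProb_sub_le (X := X t) (S := S t) h hη (c t))).2]
    rw [Finset.sum_add_distrib, Finset.sum_const, Finset.card_univ, Fintype.card_fin,
      nsmul_eq_mul] at h1
    unfold negLogLik
    linarith
  rw [hsum]
  linarith

theorem log_one_add_two_mul_le {x : ℝ} (hx : 0 < x) :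
    Real.log (1 + 2 * x) ≤ 3 * max 1 (Real.log x) := by
  set M := max 1 (Real.log x) with hM
  have h1 : 1 ≤ M := le_max_left _ _
  have h2 : x ≤ Real.exp M := (Real.log_le_iff_le_exp hx).1 (le_max_right _ _)
  have h3 : 1 ≤ Real.exp M := Real.one_le_exp (by linarith)
  have h4 : 3 ≤ Real.exp (2 * M) := by linarith [Real.add_one_le_exp (2 * M)]
  rw [Real.log_le_iff_le_exp (by positivity), show 3 * M = 2 * M + M by ring, Real.exp_add]
  have := mul_le_mul_of_nonneg_right h4 (Real.exp_pos M).le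
  linarith

/-- The union bound over a finite set of parameters; the estimator enters only through the points of
this set, so it need not be measurable. -/
theorem measure_iUnion_tail_le {n : ℕ} {Ω : Type*} [MeasurableSpace Ω] {P : Measure Ω}
    [IsProbabilityMeasure P] [IsProbabilityMeasure D]
    {X : Fin n → Ω → Fin N → ctx} {S : Fin n → Ω → Finset (Fin N)} {c : Fin n → Ω → Fin (N + 1)}
    (hdata : IsPhaseI P K n f wstar D X S c) (hf : ∀ w ∈ W, Measurable (f w))
    (hwstar : wstar ∈ W) {Cf : ℝ} (hCf : 0 ≤ Cf) (hutil : ∀ w ∈ W, ∀ x, |f w x| ≤ Cf)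
    (hκ : 0 < kappa K N f W) (hκ1 : kappa K N f W ≤ 1)
    {s : Finset (Vec m)} (hsW : (s : Set (Vec m)) ⊆ W) (hs : s.Nonempty) {δ : ℝ} (hδ : 0 < δ) :
    P (⋃ w ∈ s, {ω | Real.log (s.card / δ) -
      n * (kappa K N f W ^ 2 / 16 * sqLoss K f wstar D w) ≤
        ∑ t, halfLogRatio f wstar w (X t ω, S t ω, c t ω)}) ≤ ENNReal.ofReal δ := by
  have hcard : 0 < (s.card : ℝ) := by exact_mod_cast hs.card_pos
  have htail : ∀ w ∈ s, P {ω | Real.log (s.card / δ) -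
      n * (kappa K N f W ^ 2 / 16 * sqLoss K f wstar D w) ≤
        ∑ t, halfLogRatio f wstar w (X t ω, S t ω, c t ω)} ≤ ENNReal.ofReal (δ / s.card) := by
    intro w hw
    have hwW := hsW hw
    have hB : ∀ x, |f w x - f wstar x| ≤ Cf + Cf := fun x =>
      (abs_sub _ _).trans (add_le_add (hutil w hwW x) (hutil wstar hwstar x))
    have hL := integral_exp_halfLogRatio_le (D := D) (K := K) hκ hκ1 (hf wstar hwstar) (hf w hwW)
      (add_nonneg hCf hCf) hB (fun X S hS j hj => kappa_le hwstar X hS hj)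
      (fun X S hS j hj => kappa_le hwW X hS hj)
    have h := measure_sum_halfLogRatio_ge_le hdata (hf wstar hwstar) (hf w hwW)
      (add_nonneg hCf hCf) hB hL (Real.log (s.card / δ))
    rw [← Real.log_inv, Real.exp_log (by positivity), inv_div] at h
    exact (ENNReal.le_ofReal_iff_toReal_le (measure_ne_top _ _) (by positivity)).2 h
  refine (measure_biUnion_finset_le s _).trans ((Finset.sum_le_sum htail).trans_eq ?_)
  rw [Finset.sum_const, nsmul_eq_mul, ← ENNReal.ofReal_natCast,
    ← ENNReal.ofReal_mul hcard.le, mul_div_cancel₀ _ hcard.ne']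

theorem mul_max_log_le_zeta (K n : ℕ) (Cg δ : ℝ) :
    max 1 (Real.log (n * Cg)) * max 1 (Real.log (1 / δ)) ≤ zeta K n Cg δ := by
  rw [zeta, mul_assoc]
  exact le_mul_of_one_le_left (by positivity) (le_max_left _ _)

theorem zeta_pos (K n : ℕ) (Cg δ : ℝ) : 0 < zeta K n Cg δ := by
  unfold zeta
  positivity

/-- The dimension and the confidence level enter as a sum, here with `q` the number of net points; a
product of factors that are at least `1` dominates it. -/
theorem log_card_div_add_one_le {n p K : ℕ} {q Cg δ : ℝ} (hp : 1 ≤ p) (hn : 1 ≤ n) (hCg : 0 < Cg)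
    (hδ : 0 < δ) (hq : 0 < q) (hqp : q ≤ (1 + 2 * (n * Cg)) ^ p) :
    Real.log (q / δ) + 1 ≤ 5 * (p * zeta K n Cg δ) := by
  have hn' : (0 : ℝ) < n := by exact_mod_cast hn
  have hp' : (1 : ℝ) ≤ p := by exact_mod_cast hp
  have hz := mul_max_log_le_zeta K n Cg δ
  set A := max 1 (Real.log (n * Cg)) with hA
  set M := max 1 (Real.log (1 / δ)) with hM
  have hA1 : 1 ≤ A := le_max_left _ _
  have hM1 : 1 ≤ M := le_max_left _ _
  have h1 : Real.log q ≤ p * (3 * A) := by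
    refine (Real.log_le_log hq hqp).trans ?_
    rw [Real.log_pow]
    exact mul_le_mul_of_nonneg_left (log_one_add_two_mul_le (by positivity)) (by positivity)
  have h2 : Real.log (1 / δ) ≤ M := le_max_right _ _
  have h3 : A ≤ A * M := le_mul_of_one_le_right (by linarith) hM1
  have h4 : M ≤ A * M := le_mul_of_one_le_left (by linarith) hA1
  have h5 : A * M ≤ p * (A * M) := le_mul_of_one_le_left (by positivity) hp'
  have h6 : (p : ℝ) * A ≤ p * (A * M) := mul_le_mul_of_nonneg_left h3 (by linarith)
  have h7 : p * (A * M) ≤ p * zeta K n Cg δ := mul_le_mul_of_nonneg_left hz (by linarith)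
  rw [div_eq_mul_one_div, Real.log_mul hq.ne' (by positivity)]
  linarith

/-- The deterministic part of the rate: the loss at the estimator `u` when the tail event of the net
point `w` nearest to it does not occur. Here `q` stands for the number of net points. -/
theorem sqLoss_le_of_not_tail {n : ℕ} [IsProbabilityMeasure D] {Cf Cg Ch δ : ℝ}
    (hbdd : IsBoundedModel f W Cf Cg Ch) (hf : ∀ w ∈ W, Measurable (f w))
    (hwstar : wstar ∈ W) (hCf : 1 ≤ Cf) (hCg : 0 < Cg) (hδ : 0 < δ) (hm : 1 ≤ m) (hn : 1 ≤ n)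
    (hκ : 0 < kappa K N f W) (hκ1 : kappa K N f W ≤ 1)
    {q : ℝ} (hq : 0 < q) (hqm : q ≤ (1 + 2 * (n * Cg)) ^ m)
    {X : Fin n → Fin N → ctx} {S : Fin n → Finset (Fin N)} {c : Fin n → Fin (N + 1)}
    {u w : Vec m} (hu : u ∈ W) (hmin : IsMinOn (negLogLik f X S c) W u) (hw : w ∈ W)
    (huw : ‖u - w‖ ≤ 1 / (n * Cg))
    (htail : ∑ t, halfLogRatio f wstar w (X t, S t, c t) <
      Real.log (q / δ) - n * (kappa K N f W ^ 2 / 16 * sqLoss K f wstar D w)) :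
    sqLoss K f wstar D u ≤
      162 * (kappa K N f W ^ (-2 : ℤ) * m * Cf ^ 2 * zeta K n Cg δ / n) := by
  set κ := kappa K N f W with hκdef
  have hn' : (1 : ℝ) ≤ n := by exact_mod_cast hn
  have hn0 : (0 : ℝ) < n := by linarith
  have hm' : (1 : ℝ) ≤ m := by exact_mod_cast hm
  have hclose : ∀ x, |f u x - f w x| ≤ 1 / n := fun x => by
    refine (hbdd.lipschitz hw hu x).trans ((mul_le_mul_of_nonneg_left huw hCg.le).trans_eq ?_)
    field_simp
  have hdiff : ∀ v ∈ W, ∀ x, |f v x - f wstar x| ≤ Cf + Cf := fun v hv x =>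
    (abs_sub _ _).trans (add_le_add (hbdd.utility v hv x) (hbdd.utility wstar hwstar x))
  have hlow := neg_le_sum_halfLogRatio (f := f) hwstar hmin (by positivity) hclose
  rw [mul_one_div, div_self hn0.ne'] at hlow
  have hlog := log_card_div_add_one_le (K := K) hm hn hCg hδ hq hqm
  have hz := zeta_pos K n Cg δ
  set Z := zeta K n Cg δ with hZ
  have hZ1 : 1 ≤ Z := (one_le_mul_of_one_le_of_one_le (le_max_left _ _) (le_max_left _ _)).trans
    (mul_max_log_le_zeta K n Cg δ)
  have hCf2 : 1 ≤ Cf ^ 2 := one_le_pow₀ hCf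
  have hmZ : 1 ≤ m * Z := one_le_mul_of_one_le_of_one_le hm' hZ1
  have hmCZ : (m : ℝ) * Z ≤ m * Cf ^ 2 * Z := by
    rw [mul_right_comm]
    exact le_mul_of_one_le_right (by linarith) hCf2
  have hpow : κ ^ (-2 : ℤ) = (κ ^ 2)⁻¹ := by
    rw [zpow_neg]
    norm_cast
  have hloss : sqLoss K f wstar D w ≤ 80 * (κ ^ (-2 : ℤ) * m * Cf ^ 2 * Z / n) := by
    have h1 : sqLoss K f wstar D w * (n * κ ^ 2) ≤ 80 * (m * Cf ^ 2 * Z) := by linarith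
    rw [← le_div_iff₀ (by positivity)] at h1
    refine h1.trans_eq ?_
    rw [hpow]
    field_simp
  have hrem : (1 / (n : ℝ)) ^ 2 / κ ≤ κ ^ (-2 : ℤ) * m * Cf ^ 2 * Z / n := by
    have h1 : κ ≤ (m * Cf ^ 2 * Z) * n := by
      have : 1 ≤ (m * Cf ^ 2 * Z) * n :=
        one_le_mul_of_one_le_of_one_le (hmZ.trans hmCZ) hn'
      linarith
    have h2 : κ ^ (-2 : ℤ) * m * Cf ^ 2 * Z / n = (m * Cf ^ 2 * Z) * n / (n ^ 2 * κ ^ 2) := by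
      rw [hpow]
      field_simp
    have h3 : (1 / (n : ℝ)) ^ 2 / κ = κ / (n ^ 2 * κ ^ 2) := by field_simp
    rw [h2, h3]
    exact div_le_div_of_nonneg_right h1 (by positivity)
  have h := sqLoss_le_of_close (D := D) (K := K) hκ (hf wstar hwstar) (hf w hw) (hf u hu)
    (hdiff w hw) (hdiff u hu) hclose fun X S hS j hj => kappa_le hwstar X hS hj
  linarith

end Estimator

end MNLBandit

theorem lemma1 :
    ∃ C : ℝ, 0 < C ∧
      ∀ {d dw N K t₀ : ℕ} (_hN : 1 ≤ N) (_hK : 1 ≤ K)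
        {ctx : Set (MNLBandit.Vec d)} (W : Set (MNLBandit.Vec dw))
        (f : MNLBandit.Vec dw → ctx → ℝ) (_hf : ∀ w ∈ W, Measurable (f w))
        -- realizability
        (wstar : MNLBandit.Vec dw) (_hwstar : wstar ∈ W)
        -- boundedness
        {Cf Cg Ch : ℝ} (_hCf : 1 ≤ Cf) (_hCg : 0 < Cg) (_hCh : 0 < Ch)
        (_hbdd : MNLBandit.IsBoundedModel f W Cf Cg Ch)
        -- distribution of the contexts and the geometric condition
        (D : MeasureTheory.Measure (Fin N → ctx)) (_hD : MeasureTheory.IsProbabilityMeasure D)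
        (_hX : ∀ᵐ X ∂D, ∀ j, ‖(X j : MNLBandit.Vec d)‖ ≤ 1)
        {μ τ γ : ℝ} (_hμ : 0 < μ) (_hτ : 0 < τ) (_hγ0 : 0 < γ) (_hγ2 : γ < 2)
        (_hgeom : MNLBandit.GeometricCondition K f W wstar D μ τ γ)
        -- the data of Phase I
        {Ω : Type*} [MeasurableSpace Ω] (P : MeasureTheory.Measure Ω)
        (_hP : MeasureTheory.IsProbabilityMeasure P)
        (X : Fin t₀ → Ω → Fin N → ctx) (S : Fin t₀ → Ω → Finset (Fin N))
        (c : Fin t₀ → Ω → Fin (N + 1)) (_hdata : MNLBandit.IsPhaseI P K t₀ f wstar D X S c)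
        -- the pilot estimator
        (what : Ω → MNLBandit.Vec dw)
        (_hwhat : ∀ᵐ ω ∂P, what ω ∈ W ∧ IsMinOn
          (MNLBandit.negLogLik f (fun t => X t ω) (fun t => S t ω) (fun t => c t ω)) W (what ω))
        {δ : ℝ} (_hδ0 : 0 < δ) (_hδ1 : δ < 1)
        (_ht₀ : 2⁻¹ * C * MNLBandit.kappa K N f W ^ (-2 : ℤ) * dw * Cf ^ 2 *
          MNLBandit.zeta K t₀ Cg δ * (μ ^ (γ / (2 - γ)) / τ ^ (2 / (2 - γ))) ≤ t₀),
        -- the bound holds outside an event of probability at most `δ`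
        P {ω | C * (MNLBandit.kappa K N f W ^ (-2 : ℤ) * dw * Cf ^ 2 *
            MNLBandit.zeta K t₀ Cg δ / (μ * t₀)) <
          ⨅ v : MNLBandit.equivSet f W wstar, ‖what ω - v‖ ^ 2} ≤ ENNReal.ofReal δ := by
  refine ⟨1600, by norm_num, ?_⟩
  intro d dw N K t₀ hN hK ctx W f hf wstar hwstar Cf Cg Ch hCf hCg _ hbdd D hD _ μ τ γ hμ hτ hγ0
    hγ2 hgeom Ω _ P hP X S c hdata what hwhat δ hδ0 hδ1 ht₀
  have hmem : wstar ∈ MNLBandit.equivSet f W wstar := ⟨hwstar, fun _ => rfl⟩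
  rcases Nat.eq_zero_or_pos dw with rfl | hdw
  -- In dimension zero there is only one parameter, and the claimed bound is `0`.
  · have hempty : ∀ ω, ⨅ v : MNLBandit.equivSet f W wstar, ‖what ω - v‖ ^ 2 ≤ 0 := fun ω => by
      refine (MNLBandit.iInf_norm_sub_sq_le hmem (what ω)).trans_eq ?_
      rw [Subsingleton.elim (what ω) wstar, sub_self, norm_zero, zero_pow two_ne_zero]
    simp [(hempty _).not_gt]
  obtain ⟨X₀⟩ := MeasureTheory.nonempty_of_isProbabilityMeasure D
  have hκ : 0 < MNLBandit.kappa K N f W := MNLBandit.kappa_pos hN hK hbdd.utility hwstar X₀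
  have hκ1 : MNLBandit.kappa K N f W ≤ 1 := MNLBandit.kappa_le_one hN hK hwstar X₀
  have hZ := MNLBandit.zeta_pos K t₀ Cg δ
  have hdw' : (0 : ℝ) < dw := by exact_mod_cast hdw
  have ha : 0 < MNLBandit.kappa K N f W ^ (-2 : ℤ) * dw * Cf ^ 2 * MNLBandit.zeta K t₀ Cg δ := by
    positivity
  set a := MNLBandit.kappa K N f W ^ (-2 : ℤ) * dw * Cf ^ 2 * MNLBandit.zeta K t₀ Cg δ with ha_def
  have hratio : 0 < μ ^ (γ / (2 - γ)) / τ ^ (2 / (2 - γ)) := by positivity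
  have ht₀' : 800 * a * (μ ^ (γ / (2 - γ)) / τ ^ (2 / (2 - γ))) ≤ t₀ := by
    rw [ha_def]
    linarith
  -- For `t₀ = 0` the bound would be a division by zero; the sample size condition excludes it.
  have ht : (0 : ℝ) < t₀ := lt_of_lt_of_le (by positivity) ht₀'
  have ht1 : 1 ≤ t₀ := by exact_mod_cast ht
  obtain ⟨s, hsW, hscard, hsnet⟩ := MNLBandit.exists_finset_net hbdd.param
    (ε := 1 / (t₀ * Cg)) (by positivity)
  rw [finrank_euclideanSpace_fin, div_div_eq_mul_div, div_one] at hscard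
  have hs : s.Nonempty := by
    obtain ⟨v, hv, -⟩ := hsnet wstar hwstar
    exact ⟨v, hv⟩
  refine le_trans (MeasureTheory.measure_mono_ae ?_)
    (MNLBandit.measure_iUnion_tail_le hdata hf hwstar (by linarith) hbdd.utility hκ hκ1 hsW hs hδ0)
  filter_upwards [hwhat] with ω hω hbad
  by_contra hgood
  obtain ⟨w, hws, hclose⟩ := hsnet (what ω) hω.1
  have htail : ¬ (Real.log (s.card / δ) - t₀ * (MNLBandit.kappa K N f W ^ 2 / 16 *
      MNLBandit.sqLoss K f wstar D w) ≤
        ∑ t, MNLBandit.halfLogRatio f wstar w (X t ω, S t ω, c t ω)) := fun h =>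
    hgood (Set.mem_iUnion₂.2 ⟨w, hws, h⟩)
  have hloss := MNLBandit.sqLoss_le_of_not_tail hbdd hf hwstar hCf hCg hδ0 hdw ht1 hκ hκ1
    (by exact_mod_cast hs.card_pos) hscard hω.1 hω.2 (hsW hws) hclose (not_le.1 htail)
  rw [← ha_def] at hloss
  have hat : 0 < a / t₀ := by positivity
  have hdist := hgeom.iInf_norm_sub_sq_le_of_sqLoss_le hμ hτ hγ0 hγ2 hwstar hω.1
    (B := 200 * (a / t₀)) (by positivity) (by linarith) (by
      rw [← div_le_one ht] at ht₀'
      refine le_of_eq_of_le ?_ ht₀'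
      ring)
  have hfinal : 4 * (200 * (a / t₀)) / μ ≤ 1600 * (a / (μ * t₀)) := by
    have h1 : 4 * (200 * (a / t₀)) / μ = 800 * (a / (μ * t₀)) := by field_simp; ring
    have h2 : 0 < a / (μ * t₀) := by positivity
    linarith
  exact absurd hbad (hdist.trans hfinal).not_gt
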